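/- Let $\{\tilde\eta_j\}_{j\ge 0}$ be a (strictly) stationary centered Gaussian sequence with $\mathbb E\tilde\eta_0^2=1$ and $\mathbb E(\tilde\eta_0\tilde\eta_k)=k^{-\alpha}L(k)$ for $k=1,2,\dots$, where $\alpha\in(0,1)$ and $L$ is slowly varying at infinity (that is, $L$ is positive and measurable on some half-line $[A,\infty)$ and $L(cx)/L(x)\to 1$ as $x\to\infty$ for every $c>0$). Let $H_q(x)=(-1)^q e^{x^2/2}\frac{d^q}{dx^q}e^{-x^2/2}$ be the Hermite polynomials. Let $H:\mathbb R\to\mathbb R$ be a measurable function with $\mathbb E\,H(\tilde\eta_0)=0$ and $\mathbb E\,H^2(\tilde\eta_0)<\infty$, put $J_q=\mathbb E\big(H(\tilde\eta_0)H_q(\tilde\eta_0)\big)$, and suppose that $H$ has Hermite rank $m$, i.e. $m=\min\{q\ge 1: J_q\ne 0\}$ exists. Then, for every $\delta>0$, almost surely, as $n\to\infty$, $$\sup_{0\le t\le n}\left|\sum_{j=1}^{[t]}H(\tilde\eta_j)-\frac{J_m}{m!}\sum_{j=1}^{[t]}H_m(\tilde\eta_j)\right|=o\big(n^{\gamma/2+\delta}\big),$$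 where $[t]$ is the integer part of $t$, and $\gamma=2-(m+1)\alpha$ if $\alpha<1/(m+1)$ and $\gamma=1$ if $\alpha\ge 1/(m+1)$. -/

import Mathlib

open MeasureTheory ProbabilityTheory Filter Asymptotics
open scoped Topology

noncomputable section

/-- `L` is slowly varying at infinity: on some half-line `[A, ∞)` it is positive and measurable,
and `L (c x) / L x → 1` as `x → ∞` for every `c > 0`. -/
def SlowlyVaryingAtTop (L : ℝ → ℝ) : Prop :=
  (∃ A : ℝ, (∀ x ∈ Set.Ici A, 0 < L x) ∧ Measurable ((Set.Ici A).domRestrict L)) ∧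
    ∀ c : ℝ, 0 < c → Tendsto (fun x : ℝ => L (c * x) / L x) atTop (𝓝 1)

/-- (Strict) stationarity of a sequence of real random variables: every shifted sequence has
the same law on `ℕ → ℝ` as the sequence itself. -/
def IsStationarySeq {Ω : Type*} [MeasurableSpace Ω] (X : ℕ → Ω → ℝ) (P : Measure Ω) : Prop :=
  ∀ h : ℕ, IdentDistrib (fun ω j => X (j + h) ω) (fun ω j => X j ω) P P

/-- The `q`-th Hermite polynomial `(-1)^q e^{x²/2} (d/dx)^q e^{-x²/2}` as a real function. -/
def hermiteFun (q : ℕ) (x : ℝ) : ℝ := Polynomial.aeval x (Polynomial.hermite q)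

theorem hermiteFun_eq (q : ℕ) (x : ℝ) :
    hermiteFun q x =
      (-1 : ℝ) ^ q * Real.exp (x ^ 2 / 2) * deriv^[q] (fun y => Real.exp (-(y ^ 2 / 2))) x := by
  rw [hermiteFun, Polynomial.hermite_eq_deriv_gaussian']
  ring

/-- The Hermite coefficient `J_q = E[H(Z) H_q(Z)]`, with `Z` standard normal. -/
def hermiteCoeff (H : ℝ → ℝ) (q : ℕ) : ℝ :=
  ∫ x, H x * hermiteFun q x ∂(gaussianReal 0 1)

/-- `m` is the Hermite rank of `H`: the least `q ≥ 1` with `J_q ≠ 0`. -/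
def HasHermiteRank (H : ℝ → ℝ) (m : ℕ) : Prop :=
  IsLeast {q : ℕ | 1 ≤ q ∧ hermiteCoeff H q ≠ 0} m

/-- The exponent `γ`: `2 - (m + 1) α` if `α < 1 / (m + 1)`, and `1` otherwise. -/
def reductionExponent (α : ℝ) (m : ℕ) : ℝ :=
  if α < 1 / ((m : ℝ) + 1) then 2 - ((m : ℝ) + 1) * α else 1

/-- The difference `∑_{j=1}^{[t]} H(x_j) - (J_m / m!) ∑_{j=1}^{[t]} H_m(x_j)`, for real `t ≥ 0`. -/
def reductionError (H : ℝ → ℝ) (m : ℕ) (x : ℕ → ℝ) (t : ℝ) : ℝ :=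
  ∑ j ∈ Finset.Icc 1 ⌊t⌋₊, H (x j)
    - hermiteCoeff H m / (m.factorial : ℝ) * ∑ j ∈ Finset.Icc 1 ⌊t⌋₊, hermiteFun m (x j)

/-- On `[0, T]` the error takes finitely many values, so the supremum in the theorem is a genuine
one. -/
theorem bddAbove_reductionError (H : ℝ → ℝ) (m : ℕ) (x : ℕ → ℝ) (T : ℝ) :
    BddAbove (Set.range fun t : Set.Icc (0 : ℝ) T => |reductionError H m x t|) := by
  have hfin : ((fun k : ℕ => |reductionError H m x (k : ℝ)|) '' Set.Iic ⌊T⌋₊).Finite :=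
    (Set.finite_Iic _).image _
  refine hfin.bddAbove.mono ?_
  rintro _ ⟨t, rfl⟩
  refine ⟨⌊(t : ℝ)⌋₊, Nat.floor_mono t.2.2, ?_⟩
  simp [reductionError]

end

/-! Put `G = H - (J_m / m!) H_m`. The error at time `t` is the partial sum of `G(η_j)` up to `⌊t⌋`,
so the supremum over `[0, n]` is controlled by a maximum over `k ≤ n`. Since `H` has mean zero and
rank `m`, `G` is orthogonal to every Hermite polynomial of degree at most `m`.

For standard normal `X`, `Y` with correlation `r`, Mehler's relation `E H_p(X) H_q(Y) = p! r^p` if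
`p = q`, and `0` otherwise, diagonalises the covariance in the Hermite basis. The expansion of `G`
starts at degree `m + 1`, whence `|E G(X) G(Y)| ≤ |r|^(m+1) E G²` (`abs_integral_mul_rotation_le`).

Potter's bound `|L k| ≤ C k^ε` then makes the covariance of `G(η_i)` and `G(η_j)` of order
`d^(-(m+1)α + δ/2)` at lag `d = |i - j| ≥ 1`. Summing over lags, a block of length `k` has second
moment `O(k^(γ+δ))`. Dyadic chaining and a Borel–Cantelli type argument
(`ae_eventually_forall_abs_le_of_integral_increments_sq_le`) convert this second-moment bound into
the almost sure rate for the maximum. -/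

/-! ### Polynomials under the standard Gaussian measure. -/

theorem integrable_polynomial_gaussianReal (p : Polynomial ℝ) :
    Integrable (fun x => p.eval x) (gaussianReal 0 1) := by
  simp only [Polynomial.eval_eq_sum_range]
  refine integrable_finsetSum _ fun i _ => Integrable.const_mul ?_ _
  have := integrable_pow_of_mem_interior_integrableExpSet (X := fun x : ℝ => x)
    (μ := gaussianReal 0 1) (by simp) i
  simpa using this

theorem memLp_two_polynomial_gaussianReal (p : Polynomial ℝ) :
    MemLp (fun x => p.eval x) 2 (gaussianReal 0 1) := by
  rw [memLp_two_iff_integrable_sq (by fun_prop)]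
  have hp := integrable_polynomial_gaussianReal (p ^ 2)
  simp only [Polynomial.eval_pow] at hp
  exact hp

theorem integrable_gaussianPDFReal_mul_iff (f : ℝ → ℝ) :
    Integrable (fun x => gaussianPDFReal 0 1 x * f x) ↔ Integrable f (gaussianReal 0 1) := by
  rw [gaussianReal_of_var_ne_zero _ one_ne_zero,
    integrable_withDensity_iff_integrable_smul' (measurable_gaussianPDF _ _)
      (ae_of_all _ fun _ => gaussianPDF_lt_top)]
  simp

theorem hasDerivAt_gaussianPDFReal (x : ℝ) :
    HasDerivAt (gaussianPDFReal 0 1) (-x * gaussianPDFReal 0 1 x) x := by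
  have h : HasDerivAt (fun y : ℝ => -(y - 0) ^ 2 / (2 * ((1 : NNReal) : ℝ))) (-x) x := by
    have := ((((hasDerivAt_id x).sub_const 0).pow 2).neg).div_const (2 * ((1 : NNReal) : ℝ))
    exact (this.congr_deriv (by simp; ring)).congr_of_eventuallyEq (.of_forall fun y => by simp)
  have := (h.exp).const_mul (√(2 * Real.pi * (1 : NNReal)))⁻¹
  rw [gaussianPDFReal_def]
  exact this.congr_deriv (by ring)

/-- Gaussian integration by parts for polynomials. -/
theorem integral_mul_polynomial_gaussianReal (p : Polynomial ℝ) :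
    ∫ x, x * p.eval x ∂(gaussianReal 0 1) = ∫ x, p.derivative.eval x ∂(gaussianReal 0 1) := by
  have hx : Integrable (fun x => x * p.eval x) (gaussianReal 0 1) := by
    have hp := integrable_polynomial_gaussianReal (Polynomial.X * p)
    simp only [Polynomial.eval_mul, Polynomial.eval_X] at hp
    exact hp
  have hd := integrable_polynomial_gaussianReal p.derivative
  rw [eq_comm, ← sub_eq_zero, ← integral_sub hd hx,
    integral_gaussianReal_eq_integral_smul one_ne_zero]
  refine integral_eq_zero_of_hasDerivAt_of_integrable
    (f := fun x => gaussianPDFReal 0 1 x * p.eval x) (fun x => ?_)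
    ((integrable_gaussianPDFReal_mul_iff _).2 (hd.sub hx))
    ((integrable_gaussianPDFReal_mul_iff _).2 (integrable_polynomial_gaussianReal p))
  exact ((hasDerivAt_gaussianPDFReal x).mul (p.hasDerivAt x)).congr_deriv (by ring)

/-! ### Algebra of Hermite polynomials. -/

/-- The Hermite polynomials with real coefficients. -/
noncomputable def hermiteReal (n : ℕ) : Polynomial ℝ :=
  (Polynomial.hermite n).map (Int.castRingHom ℝ)

theorem hermiteFun_eq_eval (n : ℕ) (x : ℝ) : hermiteFun n x = (hermiteReal n).eval x := by
  rw [hermiteFun, hermiteReal, Polynomial.eval_map, Polynomial.aeval_def]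
  rfl

theorem hermiteReal_zero : hermiteReal 0 = 1 := by simp [hermiteReal]

theorem hermiteReal_succ (n : ℕ) :
    hermiteReal (n + 1) = Polynomial.X * hermiteReal n - (hermiteReal n).derivative := by
  simp [hermiteReal, Polynomial.hermite_succ, Polynomial.derivative_map]

theorem derivative_hermiteReal_succ (n : ℕ) :
    (hermiteReal (n + 1)).derivative = ((n : Polynomial ℝ) + 1) * hermiteReal n := by
  induction n with
  | zero => simp [hermiteReal_succ, hermiteReal_zero]
  | succ n ih =>
    rw [hermiteReal_succ (n + 1), Polynomial.derivative_sub, Polynomial.derivative_mul, ih,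
      Polynomial.derivative_mul]
    simp only [Polynomial.derivative_X, Polynomial.derivative_add, Polynomial.derivative_natCast,
      Polynomial.derivative_one]
    rw [hermiteReal_succ n]
    push_cast
    ring

theorem degree_hermiteReal (n : ℕ) : (hermiteReal n).degree = n := by
  rw [hermiteReal, Polynomial.degree_map_eq_of_injective (Int.cast_injective),
    Polynomial.degree_hermite]

/-! ### Correlated normal pairs `(z.1, r z.1 + s z.2)` and Mehler's relation. -/

theorem measurePreserving_rotation_gaussianReal {r s : ℝ} (h : r ^ 2 + s ^ 2 = 1) :
    MeasurePreserving (fun z : ℝ × ℝ => r * z.1 + s * z.2)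
      ((gaussianReal 0 1).prod (gaussianReal 0 1)) (gaussianReal 0 1) := by
  refine ⟨by fun_prop, ?_⟩
  have hind : IndepFun (fun z : ℝ × ℝ => r * z.1) (fun z : ℝ × ℝ => s * z.2)
      ((gaussianReal 0 1).prod (gaussianReal 0 1)) :=
    indepFun_prod (X := fun x : ℝ => r * x) (Y := fun x : ℝ => s * x) (by fun_prop) (by fun_prop)
  have h1 : Measure.map (fun z : ℝ × ℝ => r * z.1) ((gaussianReal 0 1).prod (gaussianReal 0 1)) =
      gaussianReal (r * 0) (.mk (r ^ 2) (sq_nonneg _) * 1) := by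
    rw [← gaussianReal_map_const_mul, ← Measure.fst_prod (μ := gaussianReal 0 1)
      (ν := gaussianReal 0 1), Measure.fst, Measure.map_map (by fun_prop) (by fun_prop)]
    simp [Function.comp_def]
  have h2 : Measure.map (fun z : ℝ × ℝ => s * z.2) ((gaussianReal 0 1).prod (gaussianReal 0 1)) =
      gaussianReal (s * 0) (.mk (s ^ 2) (sq_nonneg _) * 1) := by
    rw [← gaussianReal_map_const_mul, ← Measure.snd_prod (μ := gaussianReal 0 1)
      (ν := gaussianReal 0 1), Measure.snd, Measure.map_map (by fun_prop) (by fun_prop)]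
    simp [Function.comp_def]
  have := gaussianReal_add_gaussianReal_of_indepFun hind h1 h2
  have hv : NNReal.mk (r ^ 2) (sq_nonneg _) * 1 + NNReal.mk (s ^ 2) (sq_nonneg _) * 1 = 1 := by
    apply NNReal.eq
    simpa using h
  rw [hv, mul_zero, mul_zero, add_zero] at this
  exact this

theorem integrable_polynomial_mul_rotation {r s : ℝ} (h : r ^ 2 + s ^ 2 = 1)
    (f g : Polynomial ℝ) :
    Integrable (fun z : ℝ × ℝ => f.eval z.1 * g.eval (r * z.1 + s * z.2))
      ((gaussianReal 0 1).prod (gaussianReal 0 1)) := by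
  have h1 := (memLp_two_polynomial_gaussianReal f).comp_measurePreserving
    (measurePreserving_fst (μ := gaussianReal 0 1) (ν := gaussianReal 0 1))
  have h2 := (memLp_two_polynomial_gaussianReal g).comp_measurePreserving
    (measurePreserving_rotation_gaussianReal h)
  exact h1.integrable_mul h2

/-- Integration by parts in `z.1` with `z.2` frozen; the factor `r` comes from the chain rule in the
second polynomial. -/
theorem integral_mul_polynomial_mul_rotation {r s : ℝ} (h : r ^ 2 + s ^ 2 = 1)
    (f g : Polynomial ℝ) :
    ∫ z : ℝ × ℝ, z.1 * f.eval z.1 * g.eval (r * z.1 + s * z.2)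
        ∂((gaussianReal 0 1).prod (gaussianReal 0 1)) =
      ∫ z : ℝ × ℝ, f.derivative.eval z.1 * g.eval (r * z.1 + s * z.2)
        ∂((gaussianReal 0 1).prod (gaussianReal 0 1)) +
      r * ∫ z : ℝ × ℝ, f.eval z.1 * g.derivative.eval (r * z.1 + s * z.2)
        ∂((gaussianReal 0 1).prod (gaussianReal 0 1)) := by
  have i1 : Integrable (fun z : ℝ × ℝ => z.1 * f.eval z.1 * g.eval (r * z.1 + s * z.2))
      ((gaussianReal 0 1).prod (gaussianReal 0 1)) := by
    have hp := integrable_polynomial_mul_rotation h (Polynomial.X * f) g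
    simp only [Polynomial.eval_mul, Polynomial.eval_X] at hp
    exact hp
  have i2 := integrable_polynomial_mul_rotation h f.derivative g
  have i3 := (integrable_polynomial_mul_rotation h f g.derivative).const_mul r
  rw [← integral_const_mul, ← integral_add i2 i3, integral_prod_symm _ i1]
  refine Eq.trans ?_ (integral_prod_symm _ (i2.add i3)).symm
  refine integral_congr_ae (ae_of_all _ fun z => ?_)
  have := integral_mul_polynomial_gaussianReal
    (f * g.comp (Polynomial.C r * Polynomial.X + Polynomial.C (s * z)))
  simp only [Polynomial.eval_mul, Polynomial.eval_comp, Polynomial.eval_add, Polynomial.eval_C,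
    Polynomial.eval_X, Polynomial.derivative_mul, Polynomial.derivative_comp,
    Polynomial.derivative_add, Polynomial.derivative_C, Polynomial.derivative_X] at this
  simp only [mul_assoc, this]
  refine integral_congr_ae (ae_of_all _ fun x => ?_)
  simp
  ring

/-- Since `H_{p+1} = x H_p - H_p'`, integration by parts lowers `p` by one, at the price of a factor
`r` and a derivative on the other polynomial. As `H_{q+1}' = (q+1) H_q`, both indices descend
together. -/
theorem integral_hermiteReal_mul_rotation {r s : ℝ} (h : r ^ 2 + s ^ 2 = 1) (p q : ℕ) :
    ∫ z : ℝ × ℝ, (hermiteReal p).eval z.1 * (hermiteReal q).eval (r * z.1 + s * z.2)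
        ∂((gaussianReal 0 1).prod (gaussianReal 0 1)) =
      if p = q then (p.factorial : ℝ) * r ^ p else 0 := by
  have step : ∀ (p : ℕ) (g : Polynomial ℝ),
      ∫ z : ℝ × ℝ, (hermiteReal (p + 1)).eval z.1 * g.eval (r * z.1 + s * z.2)
        ∂((gaussianReal 0 1).prod (gaussianReal 0 1)) =
      r * ∫ z : ℝ × ℝ, (hermiteReal p).eval z.1 * g.derivative.eval (r * z.1 + s * z.2)
        ∂((gaussianReal 0 1).prod (gaussianReal 0 1)) := by
    intro p g
    rw [← sub_eq_of_eq_add' (integral_mul_polynomial_mul_rotation h (hermiteReal p) g),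
      ← integral_sub]
    · simp [hermiteReal_succ, sub_mul]
    · have hp := integrable_polynomial_mul_rotation h (Polynomial.X * hermiteReal p) g
      simp only [Polynomial.eval_mul, Polynomial.eval_X] at hp
      exact hp
    · exact integrable_polynomial_mul_rotation h _ g
  induction p generalizing q with
  | zero =>
    have h1 : ∫ z : ℝ × ℝ, (hermiteReal 0).eval z.1 * (hermiteReal q).eval (r * z.1 + s * z.2)
        ∂((gaussianReal 0 1).prod (gaussianReal 0 1)) =
        ∫ x, (hermiteReal q).eval x ∂(gaussianReal 0 1) := by
      have := integral_map (measurePreserving_rotation_gaussianReal h).aemeasurable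
        (f := fun x => (hermiteReal q).eval x) (by fun_prop)
      rw [(measurePreserving_rotation_gaussianReal h).map_eq] at this
      simp [hermiteReal_zero, this]
    rw [h1]
    cases q with
    | zero => simp [hermiteReal_zero]
    | succ q =>
      have hx : Integrable (fun x => x * (hermiteReal q).eval x) (gaussianReal 0 1) := by
        have hp := integrable_polynomial_gaussianReal (Polynomial.X * hermiteReal q)
        simp only [Polynomial.eval_mul, Polynomial.eval_X] at hp
        exact hp
      simp only [hermiteReal_succ, Polynomial.eval_sub, Polynomial.eval_mul, Polynomial.eval_X]
      rw [integral_sub hx (integrable_polynomial_gaussianReal _),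
        integral_mul_polynomial_gaussianReal]
      simp
  | succ p ih =>
    rw [step]
    cases q with
    | zero => simp [hermiteReal_zero]
    | succ q =>
      simp only [derivative_hermiteReal_succ, Polynomial.eval_mul, Polynomial.eval_add,
        Polynomial.eval_natCast, Polynomial.eval_one, mul_left_comm _ ((q : ℝ) + 1)]
      rw [integral_const_mul, ih]
      by_cases hpq : p = q
      · subst hpq
        simp [Nat.factorial_succ, pow_succ]
        ring
      · simp [hpq]

theorem integral_hermiteReal_mul_hermiteReal (p q : ℕ) :
    ∫ x, (hermiteReal p).eval x * (hermiteReal q).eval x ∂(gaussianReal 0 1) =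
      if p = q then (p.factorial : ℝ) else 0 := by
  have := integral_hermiteReal_mul_rotation (r := 1) (s := 0) (by norm_num) p q
  rw [integral_prod] at this
  · simpa using this
  · exact integrable_polynomial_mul_rotation (by norm_num) _ _

/-! ### Completeness of the Hermite polynomials in Gaussian `L²`. -/

/-- The positive and negative parts of `f` are densities of two finite measures with the same
characteristic function, so these measures coincide. -/
theorem ae_eq_zero_of_forall_integral_mul_cexp_eq_zero {μ : Measure ℝ} [IsFiniteMeasure μ]
    {f : ℝ → ℝ} (hf : Integrable f μ)
    (h : ∀ t : ℝ, ∫ x, (f x : ℂ) * Complex.exp (t * x * Complex.I) ∂μ = 0) : f =ᵐ[μ] 0 := by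
  have hmp : AEMeasurable (fun x => ENNReal.ofReal (f x)) μ := hf.aemeasurable.ennreal_ofReal
  have hmn : AEMeasurable (fun x => ENNReal.ofReal (-f x)) μ := hf.neg.aemeasurable.ennreal_ofReal
  have hfp : IsFiniteMeasure (μ.withDensity fun x => ENNReal.ofReal (f x)) :=
    isFiniteMeasure_withDensity_ofReal hf.2
  have hfn : IsFiniteMeasure (μ.withDensity fun x => ENNReal.ofReal (-f x)) :=
    isFiniteMeasure_withDensity_ofReal hf.neg.2
  have hexp : ∀ (g : ℝ → ℝ) (_ : Integrable g μ) (t : ℝ),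
      Integrable (fun x => (g x : ℂ) * Complex.exp (t * x * Complex.I)) μ := by
    intro g hg t
    refine hg.ofReal.mul_bdd (c := 1) (by fun_prop) (ae_of_all _ fun x => ?_)
    have := Complex.norm_exp_ofReal_mul_I (t * x)
    push_cast at this
    exact this.le
  have heq : (μ.withDensity fun x => ENNReal.ofReal (f x)) =
      μ.withDensity fun x => ENNReal.ofReal (-f x) := by
    refine Measure.ext_of_charFun (funext fun t => ?_)
    rw [charFun_apply_real, charFun_apply_real,
      integral_withDensity_eq_integral_toReal_smul₀ hmp (ae_of_all _ fun _ => ENNReal.ofReal_lt_top),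
      integral_withDensity_eq_integral_toReal_smul₀ hmn (ae_of_all _ fun _ => ENNReal.ofReal_lt_top),
      ← sub_eq_zero]
    simp only [Complex.real_smul, ENNReal.toReal_ofReal']
    rw [← integral_sub (hexp _ hf.pos_part t) (hexp _ hf.neg_part t), ← h t]
    refine integral_congr_ae (ae_of_all _ fun x => ?_)
    simp only [← sub_mul, ← Complex.ofReal_sub]
    congr 2
    rcases le_total 0 (f x) with h0 | h0
    · rw [max_eq_left h0, max_eq_right (by linarith)]; ring
    · rw [max_eq_right h0, max_eq_left (by linarith)]; ring
  rw [withDensity_eq_iff_of_sigmaFinite hmp hmn] at heq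
  filter_upwards [heq] with x hx
  simp only [Pi.zero_apply]
  by_contra hne
  rcases lt_or_gt_of_ne hne with h0 | h0
  · rw [ENNReal.ofReal_of_nonpos h0.le, eq_comm, ENNReal.ofReal_eq_zero] at hx
    linarith
  · rw [ENNReal.ofReal_of_nonpos (by linarith : -f x ≤ 0), ENNReal.ofReal_eq_zero] at hx
    linarith

theorem memLp_two_exp_abs_mul_gaussianReal (t : ℝ) :
    MemLp (fun x => Real.exp (|t * x|)) 2 (gaussianReal 0 1) := by
  rw [memLp_two_iff_integrable_sq (by fun_prop)]
  have h := (integrable_exp_mul_gaussianReal (μ := 0) (v := 1) (2 * t)).add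
    (integrable_exp_mul_gaussianReal (μ := 0) (v := 1) (-(2 * t)))
  refine h.mono' (by fun_prop) (ae_of_all _ fun x => ?_)
  simp only [Pi.add_apply, Real.norm_eq_abs, Real.abs_exp, ← Real.exp_nat_mul]
  rcases abs_cases (t * x) with ⟨h1, _⟩ | ⟨h1, _⟩ <;> rw [h1]
  · refine le_add_of_le_of_nonneg (le_of_eq ?_) (Real.exp_pos _).le
    push_cast; ring_nf
  · refine le_add_of_nonneg_of_le (Real.exp_pos _).le (le_of_eq ?_)
    push_cast; ring_nf

/-- Expand `exp(itx)` in powers of `x` and integrate term by term. The dominating function `|f|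
exp|tx|` is integrable as a product of two `L²` functions. -/
theorem ae_eq_zero_of_forall_integral_mul_pow_eq_zero {f : ℝ → ℝ}
    (hf : MemLp f 2 (gaussianReal 0 1))
    (h : ∀ n : ℕ, ∫ x, f x * x ^ n ∂(gaussianReal 0 1) = 0) : f =ᵐ[gaussianReal 0 1] 0 := by
  refine ae_eq_zero_of_forall_integral_mul_cexp_eq_zero (hf.integrable one_le_two) fun t => ?_
  have hsum : ∀ x : ℝ, HasSum (fun n : ℕ => |f x| * (|t * x| ^ n / n.factorial))
      (|f x| * Real.exp |t * x|) := fun x => by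
    have := NormedSpace.expSeries_div_hasSum_exp (𝔸 := ℝ) |t * x|
    rw [← Real.exp_eq_exp_ℝ] at this
    exact this.mul_left _
  have hs := hasSum_integral_of_dominated_convergence (μ := gaussianReal 0 1)
    (F := fun (n : ℕ) (x : ℝ) => (f x : ℂ) * ((t * x * Complex.I) ^ n / n.factorial))
    (f := fun x => (f x : ℂ) * Complex.exp (t * x * Complex.I))
    (fun n x => |f x| * (|t * x| ^ n / n.factorial))
    (fun n => (Complex.continuous_ofReal.comp_aestronglyMeasurable hf.1).mul
      (Continuous.aestronglyMeasurable (by fun_prop)))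
    (fun n => ae_of_all _ fun x => by simp [abs_mul])
    (ae_of_all _ fun x => (hsum x).summable)
    (by
      simp only [(hsum _).tsum_eq]
      exact hf.abs.integrable_mul (memLp_two_exp_abs_mul_gaussianReal t))
    (ae_of_all _ fun x => by
      have := NormedSpace.expSeries_div_hasSum_exp (𝔸 := ℂ) (t * x * Complex.I)
      rw [← Complex.exp_eq_exp_ℂ] at this
      exact this.mul_left _)
  have h0 : ∀ n : ℕ, ∫ x, (f x : ℂ) * ((t * x * Complex.I) ^ n / n.factorial)
      ∂(gaussianReal 0 1) = 0 := fun n => by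
    have : ∀ x : ℝ, (f x : ℂ) * ((t * x * Complex.I) ^ n / n.factorial) =
        ((t * Complex.I) ^ n / n.factorial) * ((f x * x ^ n : ℝ) : ℂ) := fun x => by
      push_cast; ring
    simp only [this]
    rw [integral_const_mul, integral_complex_ofReal, h n]
    simp
  simp only [h0] at hs
  exact hs.unique hasSum_zero

theorem ae_eq_zero_of_forall_integral_mul_hermiteReal_eq_zero {f : ℝ → ℝ}
    (hf : MemLp f 2 (gaussianReal 0 1))
    (h : ∀ n : ℕ, ∫ x, f x * (hermiteReal n).eval x ∂(gaussianReal 0 1) = 0) :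
    f =ᵐ[gaussianReal 0 1] 0 := by
  have hint : ∀ p : Polynomial ℝ, Integrable (fun x => f x * p.eval x) (gaussianReal 0 1) :=
    fun p => hf.integrable_mul (memLp_two_polynomial_gaussianReal p)
  have hspan : Submodule.span ℝ (Set.range hermiteReal) = ⊤ :=
    Polynomial.Sequence.span (⟨hermiteReal, degree_hermiteReal⟩ : Polynomial.Sequence ℝ)
      fun i => isUnit_iff_ne_zero.2 <| Polynomial.leadingCoeff_ne_zero.2 <|
        Polynomial.Sequence.ne_zero ⟨hermiteReal, degree_hermiteReal⟩ i
  have hall : ∀ p : Polynomial ℝ, ∫ x, f x * p.eval x ∂(gaussianReal 0 1) = 0 := by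
    intro p
    have hp : p ∈ Submodule.span ℝ (Set.range hermiteReal) := hspan ▸ Submodule.mem_top
    induction hp using Submodule.span_induction with
    | mem x hx => obtain ⟨n, rfl⟩ := hx; exact h n
    | zero => simp
    | add p q _ _ hp hq =>
      simp only [Polynomial.eval_add, mul_add]
      rw [integral_add (hint p) (hint q), hp, hq, add_zero]
    | smul c p _ hp =>
      simp only [Polynomial.eval_smul, smul_eq_mul, mul_left_comm _ c]
      rw [integral_const_mul, hp, mul_zero]
  refine ae_eq_zero_of_forall_integral_mul_pow_eq_zero hf fun n => ?_
  have := hall (Polynomial.X ^ n)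
  simp only [Polynomial.eval_pow, Polynomial.eval_X] at this
  exact this

/-! ### The Hermite basis. -/

/-- The normalized Hermite polynomials in `L²` of the standard Gaussian measure. -/
noncomputable def hermiteLp (n : ℕ) : Lp ℝ 2 (gaussianReal 0 1) :=
  (√(n.factorial : ℝ))⁻¹ • (memLp_two_polynomial_gaussianReal (hermiteReal n)).toLp

theorem coeFn_hermiteLp (n : ℕ) :
    hermiteLp n =ᵐ[gaussianReal 0 1] fun x => (√(n.factorial : ℝ))⁻¹ * (hermiteReal n).eval x := by
  filter_upwards [Lp.coeFn_smul (√(n.factorial : ℝ))⁻¹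
    (memLp_two_polynomial_gaussianReal (hermiteReal n)).toLp,
    (memLp_two_polynomial_gaussianReal (hermiteReal n)).coeFn_toLp] with x h1 h2
  rw [hermiteLp, h1, Pi.smul_apply, h2, smul_eq_mul]

theorem inner_hermiteLp (n : ℕ) (f : Lp ℝ 2 (gaussianReal 0 1)) :
    inner ℝ (hermiteLp n) f =
      (√(n.factorial : ℝ))⁻¹ * ∫ x, f x * (hermiteReal n).eval x ∂(gaussianReal 0 1) := by
  rw [L2.inner_def, ← integral_const_mul]
  refine integral_congr_ae ?_
  filter_upwards [coeFn_hermiteLp n] with x hx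
  simp [hx]
  ring

theorem orthonormal_hermiteLp : Orthonormal ℝ hermiteLp := by
  rw [orthonormal_iff_ite]
  intro p q
  rw [inner_hermiteLp]
  have : ∫ x, hermiteLp q x * (hermiteReal p).eval x ∂(gaussianReal 0 1) =
      (√(q.factorial : ℝ))⁻¹ * if q = p then (q.factorial : ℝ) else 0 := by
    rw [← integral_hermiteReal_mul_hermiteReal, ← integral_const_mul]
    refine integral_congr_ae ?_
    filter_upwards [coeFn_hermiteLp q] with x hx
    rw [hx, mul_assoc]
  rw [this]
  by_cases hpq : p = q
  · subst hpq
    have : (0 : ℝ) < p.factorial := by positivity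
    have h2 := Real.mul_self_sqrt this.le
    have : √(p.factorial : ℝ) ≠ 0 := (Real.sqrt_pos.2 this).ne'
    simp only [if_true]
    nth_rw 3 [← h2]
    field_simp
  · simp [hpq, Ne.symm hpq]

/-- The Hermite basis of `L²` of the standard Gaussian measure. -/
noncomputable def hermiteBasis : HilbertBasis ℕ ℝ (Lp ℝ 2 (gaussianReal 0 1)) :=
  HilbertBasis.mkOfOrthogonalEqBot orthonormal_hermiteLp <| by
    rw [Submodule.eq_bot_iff]
    intro f hf
    rw [Submodule.mem_orthogonal] at hf
    refine (Lp.eq_zero_iff_ae_eq_zero).2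
      (ae_eq_zero_of_forall_integral_mul_hermiteReal_eq_zero (Lp.memLp f) fun n => ?_)
    have := hf (hermiteLp n) (Submodule.subset_span ⟨n, rfl⟩)
    rw [inner_hermiteLp] at this
    refine (mul_eq_zero.1 this).resolve_left ?_
    positivity

theorem hermiteBasis_apply (n : ℕ) : hermiteBasis n = hermiteLp n := by
  simp [hermiteBasis]

/-! ### Covariance decay from Hermite rank. -/

/-- With coefficients `c_i` of `f`, the inner product is `∑ c_i² r^i`. Terms with `i < k` vanish,
the others have `|r|^i ≤ |r|^k`, and Parseval sums the `c_i²`. -/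
theorem HilbertBasis.abs_inner_map_le_of_diagonal {E F : Type*} [NormedAddCommGroup E]
    [InnerProductSpace ℝ E] [NormedAddCommGroup F] [InnerProductSpace ℝ F]
    (b : HilbertBasis ℕ ℝ E) (U V : E →L[ℝ] F) {r : ℝ} (hr : |r| ≤ 1)
    (hUV : ∀ p q, inner ℝ (U (b p)) (V (b q)) = if p = q then r ^ p else 0)
    {k : ℕ} {f : E} (hf : ∀ q < k, inner ℝ (b q) f = 0) :
    |inner ℝ (U f) (V f)| ≤ |r| ^ k * ‖f‖ ^ 2 := by
  have hrepr := b.hasSum_repr f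
  have hcoef : ∀ i, inner ℝ (U (b i)) (V f) = b.repr f i * r ^ i := fun i => by
    have h1 := (hrepr.mapL V).mapL (innerSL ℝ (U (b i)))
    simp only [map_smul, innerSL_apply_apply, hUV, smul_eq_mul] at h1
    refine h1.unique ?_
    have h2 := hasSum_single (f := fun j => b.repr f j * if i = j then r ^ i else 0) i
      (fun j hj => by simp [Ne.symm hj])
    simpa using h2
  have hsum : HasSum (fun i => b.repr f i ^ 2 * r ^ i) (inner ℝ (U f) (V f)) := by
    have h1 := (hrepr.mapL U).mapL (innerSL ℝ (V f))
    simp only [map_smul, innerSL_apply_apply, smul_eq_mul, real_inner_comm _ (V f), hcoef] at h1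
    have e : ∀ i, b.repr f i ^ 2 * r ^ i = b.repr f i * (b.repr f i * r ^ i) := fun i => by ring
    simpa only [e] using h1
  have hsq : HasSum (fun i => b.repr f i ^ 2) (‖f‖ ^ 2) := by
    have := b.hasSum_inner_mul_inner f f
    rw [real_inner_self_eq_norm_sq] at this
    have e : ∀ i, b.repr f i ^ 2 = inner ℝ f (b i) * inner ℝ (b i) f := fun i => by
      rw [b.repr_apply_apply, real_inner_comm f, sq]
    simpa only [e] using this
  have hle : ∀ i, |b.repr f i ^ 2 * r ^ i| ≤ |r| ^ k * b.repr f i ^ 2 := fun i => by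
    rcases lt_or_ge i k with hi | hi
    · rw [b.repr_apply_apply, hf i hi]; simp
    · rw [abs_mul, abs_pow, abs_pow, sq_abs, mul_comm]
      exact mul_le_mul_of_nonneg_right (pow_le_pow_of_le_one (abs_nonneg r) hr hi) (sq_nonneg _)
  have hs2 := hsq.mul_left (|r| ^ k)
  exact abs_le.2 ⟨hasSum_le (fun i => (abs_le.1 (hle i)).1) hs2.neg hsum,
    hasSum_le (fun i => (abs_le.1 (hle i)).2) hsum hs2⟩

/-- If `G` is orthogonal to the Hermite polynomials of degree less than `k`, then
`|E G(X) G(Y)| ≤ |r|^k E G(X)²` for standard normal `X`, `Y` with correlation `r`. -/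
theorem abs_integral_mul_rotation_le {r s : ℝ} (h : r ^ 2 + s ^ 2 = 1) {G : ℝ → ℝ}
    (hG : MemLp G 2 (gaussianReal 0 1)) {k : ℕ}
    (hk : ∀ q < k, ∫ x, G x * (hermiteReal q).eval x ∂(gaussianReal 0 1) = 0) :
    |∫ z : ℝ × ℝ, G z.1 * G (r * z.1 + s * z.2) ∂((gaussianReal 0 1).prod (gaussianReal 0 1))| ≤
      |r| ^ k * ∫ x, G x ^ 2 ∂(gaussianReal 0 1) := by
  have hfst := measurePreserving_fst (μ := gaussianReal 0 1) (ν := gaussianReal 0 1)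
  have hrot := measurePreserving_rotation_gaussianReal h
  -- `U` and `V` evaluate a function at the two members of a normal pair with correlation `r`;
  -- Mehler's relation says that they are diagonal against each other in the Hermite basis.
  set U : Lp ℝ 2 (gaussianReal 0 1) →L[ℝ] Lp ℝ 2 ((gaussianReal 0 1).prod (gaussianReal 0 1)) :=
    (Lp.compMeasurePreservingₗᵢ ℝ Prod.fst hfst).toContinuousLinearMap with hU
  set V : Lp ℝ 2 (gaussianReal 0 1) →L[ℝ] Lp ℝ 2 ((gaussianReal 0 1).prod (gaussianReal 0 1)) :=
    (Lp.compMeasurePreservingₗᵢ ℝ _ hrot).toContinuousLinearMap with hV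
  have hUV : ∀ (f g : Lp ℝ 2 (gaussianReal 0 1)) (f' g' : ℝ → ℝ),
      f =ᵐ[gaussianReal 0 1] f' → g =ᵐ[gaussianReal 0 1] g' → inner ℝ (U f) (V g) =
      ∫ z : ℝ × ℝ, f' z.1 * g' (r * z.1 + s * z.2)
        ∂((gaussianReal 0 1).prod (gaussianReal 0 1)) := by
    intro f g f' g' hf hg
    rw [L2.inner_def]
    refine integral_congr_ae ?_
    have h1 : U f =ᵐ[(gaussianReal 0 1).prod (gaussianReal 0 1)] f ∘ Prod.fst :=
      Lp.coeFn_compMeasurePreserving f hfst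
    have h2 : V g =ᵐ[(gaussianReal 0 1).prod (gaussianReal 0 1)]
        g ∘ fun z : ℝ × ℝ => r * z.1 + s * z.2 := Lp.coeFn_compMeasurePreserving g hrot
    filter_upwards [h1, h2, hfst.quasiMeasurePreserving.ae_eq_comp hf,
      hrot.quasiMeasurePreserving.ae_eq_comp hg] with z e1 e2 e3 e4
    rw [e1, e2, e3, e4]
    simp [mul_comm]
  have hbasis : ∀ p q, inner ℝ (U (hermiteBasis p)) (V (hermiteBasis q)) =
      if p = q then r ^ p else 0 := by
    intro p q
    rw [hermiteBasis_apply, hermiteBasis_apply,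
      hUV _ _ _ _ (coeFn_hermiteLp p) (coeFn_hermiteLp q)]
    have : ∀ z : ℝ × ℝ, (√(p.factorial : ℝ))⁻¹ * (hermiteReal p).eval z.1 *
        ((√(q.factorial : ℝ))⁻¹ * (hermiteReal q).eval (r * z.1 + s * z.2)) =
        (√(p.factorial : ℝ))⁻¹ * (√(q.factorial : ℝ))⁻¹ *
          ((hermiteReal p).eval z.1 * (hermiteReal q).eval (r * z.1 + s * z.2)) := fun z => by ring
    simp only [this]
    rw [integral_const_mul, integral_hermiteReal_mul_rotation h]
    by_cases hpq : p = q
    · subst hpq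
      have hpos : (0 : ℝ) < p.factorial := by positivity
      simp only [if_true]
      rw [← mul_inv, Real.mul_self_sqrt hpos.le, inv_mul_cancel_left₀ hpos.ne']
    · simp [hpq]
  have hr : |r| ≤ 1 := abs_le_one_iff_mul_self_le_one.2 (by nlinarith [sq_nonneg s])
  have hcoef : ∀ q < k, inner ℝ (hermiteBasis q) hG.toLp = 0 := fun q hq => by
    rw [hermiteBasis_apply, inner_hermiteLp, mul_eq_zero]
    right
    refine Eq.trans (integral_congr_ae ?_) (hk q hq)
    filter_upwards [hG.coeFn_toLp] with x hx
    rw [hx]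
  have hmain := hermiteBasis.abs_inner_map_le_of_diagonal U V hr hbasis hcoef
  rw [hUV _ _ _ _ hG.coeFn_toLp hG.coeFn_toLp] at hmain
  convert hmain using 2
  rw [← real_inner_self_eq_norm_sq, L2.inner_def]
  refine integral_congr_ae ?_
  filter_upwards [hG.coeFn_toLp] with x hx
  rw [hx]
  simp [sq]

/-! ### Reduction of a jointly Gaussian pair to the rotation model. -/

/-- The characteristic function of a Gaussian measure depends only on the mean and variance of each
linear functional, and on the plane these are combinations of the five moments. -/
theorem IsGaussian.ext_of_moments_prod {μ ν : Measure (ℝ × ℝ)} [IsGaussian μ] [IsGaussian ν]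
    (h1 : ∫ z, z.1 ∂μ = ∫ z, z.1 ∂ν) (h2 : ∫ z, z.2 ∂μ = ∫ z, z.2 ∂ν)
    (h11 : ∫ z, z.1 ^ 2 ∂μ = ∫ z, z.1 ^ 2 ∂ν) (h22 : ∫ z, z.2 ^ 2 ∂μ = ∫ z, z.2 ^ 2 ∂ν)
    (h12 : ∫ z, z.1 * z.2 ∂μ = ∫ z, z.1 * z.2 ∂ν) : μ = ν := by
  refine Measure.ext_of_charFunDual (funext fun L => ?_)
  have hL : ∀ z : ℝ × ℝ, L z = L (1, 0) * z.1 + L (0, 1) * z.2 := fun z => by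
    have : z = z.1 • ((1 : ℝ), (0 : ℝ)) + z.2 • ((0 : ℝ), (1 : ℝ)) := by ext <;> simp
    conv_lhs => rw [this, map_add, map_smul, map_smul]
    simp [mul_comm]
  have hmom : ∀ (ρ : Measure (ℝ × ℝ)) [IsGaussian ρ],
      ρ[L] = L (1, 0) * ∫ z, z.1 ∂ρ + L (0, 1) * ∫ z, z.2 ∂ρ ∧
      ρ[(L : ℝ × ℝ → ℝ) ^ 2] = L (1, 0) ^ 2 * ∫ z, z.1 ^ 2 ∂ρ +
        (2 * L (1, 0) * L (0, 1) * ∫ z, z.1 * z.2 ∂ρ + L (0, 1) ^ 2 * ∫ z, z.2 ^ 2 ∂ρ) := by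
    intro ρ _
    have m1 : MemLp (fun z : ℝ × ℝ => z.1) 2 ρ :=
      IsGaussian.memLp_dual ρ (ContinuousLinearMap.fst ℝ ℝ ℝ) 2 (by simp)
    have m2 : MemLp (fun z : ℝ × ℝ => z.2) 2 ρ :=
      IsGaussian.memLp_dual ρ (ContinuousLinearMap.snd ℝ ℝ ℝ) 2 (by simp)
    have i1 := m1.integrable one_le_two
    have i2 := m2.integrable one_le_two
    constructor
    · rw [integral_congr_ae (ae_of_all _ hL), integral_add (i1.const_mul _) (i2.const_mul _), integral_const_mul, integral_const_mul]
    · have e : ∀ z : ℝ × ℝ, ((L : ℝ × ℝ → ℝ) ^ 2) z = L (1, 0) ^ 2 * z.1 ^ 2 +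
          (2 * L (1, 0) * L (0, 1) * (z.1 * z.2) + L (0, 1) ^ 2 * z.2 ^ 2) := fun z => by
        rw [Pi.pow_apply, hL]; ring
      rw [integral_congr_ae (ae_of_all _ e)]
      have j12 : Integrable (fun z : ℝ × ℝ => z.1 * z.2) ρ := m1.integrable_mul m2
      have j1 := m1.integrable_sq.const_mul (L (1, 0) ^ 2)
      have j3 := m2.integrable_sq.const_mul (L (0, 1) ^ 2)
      have j2 := j12.const_mul (2 * L (1, 0) * L (0, 1))
      have j23 : Integrable (fun z : ℝ × ℝ =>
          2 * L (1, 0) * L (0, 1) * (z.1 * z.2) + L (0, 1) ^ 2 * z.2 ^ 2) ρ := j2.add j3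
      rw [integral_add j1 j23, integral_add j2 j3, integral_const_mul, integral_const_mul,
        integral_const_mul]
  have hLm : ∀ (ρ : Measure (ℝ × ℝ)) [IsGaussian ρ], MemLp L 2 ρ := fun ρ _ =>
    IsGaussian.memLp_dual ρ L 2 (by simp)
  rw [IsGaussian.charFunDual_eq, IsGaussian.charFunDual_eq, variance_eq_sub (hLm μ),
    variance_eq_sub (hLm ν), integral_complex_ofReal, integral_complex_ofReal,
    (hmom μ).1, (hmom μ).2, (hmom ν).1, (hmom ν).2, h1, h2, h11, h22, h12]

theorem map_pair_eq_of_hasGaussianLaw {Ω : Type*} [MeasurableSpace Ω] {P : Measure Ω}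
    {X Y : Ω → ℝ} (hXY : HasGaussianLaw (fun ω => (X ω, Y ω)) P)
    (hX : P.map X = gaussianReal 0 1) (hY : P.map Y = gaussianReal 0 1) {r s : ℝ}
    (hr : ∫ ω, X ω * Y ω ∂P = r) (hrs : r ^ 2 + s ^ 2 = 1) :
    P.map (fun ω => (X ω, Y ω)) =
      ((gaussianReal 0 1).prod (gaussianReal 0 1)).map
        (fun z : ℝ × ℝ => (z.1, r * z.1 + s * z.2)) := by
  have : IsGaussian (P.map (fun ω => (X ω, Y ω))) := hXY.isGaussian_map
  have : IsGaussian (((gaussianReal 0 1).prod (gaussianReal 0 1)).map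
      (fun z : ℝ × ℝ => (z.1, r * z.1 + s * z.2))) := by
    exact isGaussian_map (μ := (gaussianReal 0 1).prod (gaussianReal 0 1))
      ((ContinuousLinearMap.fst ℝ ℝ ℝ).prod
        (r • ContinuousLinearMap.fst ℝ ℝ ℝ + s • ContinuousLinearMap.snd ℝ ℝ ℝ))
  have hm : AEMeasurable (fun ω => (X ω, Y ω)) P := hXY.aemeasurable
  have hmX : AEMeasurable X P := measurable_fst.comp_aemeasurable hm
  have hmY : AEMeasurable Y P := measurable_snd.comp_aemeasurable hm
  have e1 : (P.map (fun ω => (X ω, Y ω))).map Prod.fst = gaussianReal 0 1 := by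
    rw [AEMeasurable.map_map_of_aemeasurable (by fun_prop) hm]; exact hX
  have e2 : (P.map (fun ω => (X ω, Y ω))).map Prod.snd = gaussianReal 0 1 := by
    rw [AEMeasurable.map_map_of_aemeasurable (by fun_prop) hm]; exact hY
  have hprod : AEMeasurable (fun z : ℝ × ℝ => (z.1, r * z.1 + s * z.2))
      ((gaussianReal 0 1).prod (gaussianReal 0 1)) := by fun_prop
  have e3 : (((gaussianReal 0 1).prod (gaussianReal 0 1)).map
      (fun z : ℝ × ℝ => (z.1, r * z.1 + s * z.2))).map Prod.fst = gaussianReal 0 1 := by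
    rw [AEMeasurable.map_map_of_aemeasurable (by fun_prop) hprod]
    exact (measurePreserving_fst (μ := gaussianReal 0 1) (ν := gaussianReal 0 1)).map_eq
  have e4 : (((gaussianReal 0 1).prod (gaussianReal 0 1)).map
      (fun z : ℝ × ℝ => (z.1, r * z.1 + s * z.2))).map Prod.snd = gaussianReal 0 1 := by
    rw [AEMeasurable.map_map_of_aemeasurable (by fun_prop) hprod]
    exact (measurePreserving_rotation_gaussianReal hrs).map_eq
  have key : ∀ (ρ ρ' : Measure (ℝ × ℝ)) (π : ℝ × ℝ → ℝ) (_ : Measurable π)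
      (_ : ρ.map π = gaussianReal 0 1) (_ : ρ'.map π = gaussianReal 0 1) (n : ℕ),
      ∫ z, π z ^ n ∂ρ = ∫ z, π z ^ n ∂ρ' := by
    intro ρ ρ' π hπ h h' n
    rw [← integral_map (f := fun x => x ^ n) hπ.aemeasurable (by fun_prop),
      ← integral_map (f := fun x => x ^ n) (μ := ρ') hπ.aemeasurable (by fun_prop), h, h']
  refine IsGaussian.ext_of_moments_prod ?_ ?_ (key _ _ _ measurable_fst e1 e3 2)
    (key _ _ _ measurable_snd e2 e4 2) ?_
  · simpa using key _ _ _ measurable_fst e1 e3 1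
  · simpa using key _ _ _ measurable_snd e2 e4 1
  · rw [integral_map hm (by fun_prop), integral_map hprod (by fun_prop), hr]
    have := integral_mul_polynomial_mul_rotation hrs 1 Polynomial.X
    simpa using this.symm

theorem abs_integral_comp_mul_comp_le {Ω : Type*} [MeasurableSpace Ω] {P : Measure Ω}
    {X Y : Ω → ℝ} (hXY : HasGaussianLaw (fun ω => (X ω, Y ω)) P)
    (hX : P.map X = gaussianReal 0 1) (hY : P.map Y = gaussianReal 0 1) {r : ℝ}
    (hr : ∫ ω, X ω * Y ω ∂P = r) (hr1 : |r| ≤ 1) {G : ℝ → ℝ}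
    (hG : MemLp G 2 (gaussianReal 0 1)) {k : ℕ}
    (hk : ∀ q < k, ∫ x, G x * (hermiteReal q).eval x ∂(gaussianReal 0 1) = 0) :
    |∫ ω, G (X ω) * G (Y ω) ∂P| ≤ |r| ^ k * ∫ x, G x ^ 2 ∂(gaussianReal 0 1) := by
  have hrs : r ^ 2 + √(1 - r ^ 2) ^ 2 = 1 := by
    rw [Real.sq_sqrt (by nlinarith [abs_le_one_iff_mul_self_le_one.1 hr1])]; ring
  have hmap := map_pair_eq_of_hasGaussianLaw hXY hX hY hr hrs
  have hm : AEMeasurable (fun ω => (X ω, Y ω)) P := hXY.aemeasurable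
  have hmX : AEMeasurable X P := measurable_fst.comp_aemeasurable hm
  have hmY : AEMeasurable Y P := measurable_snd.comp_aemeasurable hm
  have hmeas : AEStronglyMeasurable (fun z : ℝ × ℝ => G z.1 * G z.2)
      (P.map (fun ω => (X ω, Y ω))) := by
    have q1 : Measure.QuasiMeasurePreserving Prod.fst (P.map (fun ω => (X ω, Y ω)))
        (gaussianReal 0 1) := ⟨measurable_fst, by
      rw [AEMeasurable.map_map_of_aemeasurable (by fun_prop) hm, ← hX]; exact .rfl⟩
    have q2 : Measure.QuasiMeasurePreserving Prod.snd (P.map (fun ω => (X ω, Y ω)))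
        (gaussianReal 0 1) := ⟨measurable_snd, by
      rw [AEMeasurable.map_map_of_aemeasurable (by fun_prop) hm, ← hY]; exact .rfl⟩
    exact (hG.1.comp_quasiMeasurePreserving q1).mul (hG.1.comp_quasiMeasurePreserving q2)
  have := integral_map hm hmeas
  rw [← this, hmap, integral_map (by fun_prop) (hmap ▸ hmeas)]
  exact abs_integral_mul_rotation_le hrs hG hk

/-! ### Slowly varying functions: uniform convergence and Potter's bound. -/

/-- Uniform convergence theorem for slowly varying functions, in additive form. -/
theorem exists_forall_abs_add_sub_lt {h : ℝ → ℝ} (hm : Measurable h)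
    (hlim : ∀ u : ℝ, Tendsto (fun x => h (x + u) - h x) atTop (𝓝 0)) {ε : ℝ} (hε : 0 < ε) :
    ∃ X : ℝ, ∀ x, X ≤ x → ∀ u ∈ Set.Icc (0 : ℝ) 1, |h (x + u) - h x| < ε := by
  by_contra! hcon
  choose x hx u hu hxu using fun n : ℕ => hcon n
  have hx' : Tendsto x atTop atTop := tendsto_atTop_mono hx tendsto_natCast_atTop_atTop
  have hy' : Tendsto (fun n => x n + u n) atTop atTop :=
    tendsto_atTop_mono (fun n => by linarith [hx n, (hu n).1]) tendsto_natCast_atTop_atTop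
  have hmeas : ∀ (y : ℕ → ℝ), Tendsto y atTop atTop → ∀ b : ℝ,
      Tendsto (fun n => volume (Set.Icc 0 b ∩ {t | ε / 2 ≤ |h (y n + t) - h (y n)|})) atTop
        (𝓝 0) := by
    intro y hy b
    have h1 : TendstoInMeasure (volume.restrict (Set.Icc 0 b))
        (fun n t => h (y n + t) - h (y n)) atTop (fun _ => (0 : ℝ)) :=
      tendstoInMeasure_of_tendsto_ae (fun n => Measurable.aestronglyMeasurable (by fun_prop))
        (ae_of_all _ fun t => (hlim t).comp hy)
    rw [tendstoInMeasure_iff_norm] at h1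
    refine (h1 (ε / 2) (half_pos hε)).congr fun n => ?_
    rw [Measure.restrict_apply (measurableSet_le (by fun_prop) (by fun_prop)), Set.inter_comm]
    simp
  have hB := hmeas x hx' 2
  have hC := hmeas _ hy' 1
  have hsum := hC.add hB
  rw [add_zero] at hsum
  obtain ⟨n, hn⟩ := (hsum.eventually (gt_mem_nhds (zero_lt_one : (0 : ENNReal) < 1))).exists
  refine absurd hn (not_lt.2 ?_)
  -- A jump of size `ε` between `x n` and `x n + u n` forces `h (x n + u n + t)` to be at least `ε /
  -- 2` away from one of the two values, whatever `t` is. So two sets whose measures tend to zero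
  -- would cover the unit interval.
  have hcover : Set.Icc (0 : ℝ) 1 ⊆
      (Set.Icc 0 1 ∩ {t | ε / 2 ≤ |h (x n + u n + t) - h (x n + u n)|}) ∪
      (fun t => t + u n) ⁻¹' (Set.Icc 0 2 ∩ {t | ε / 2 ≤ |h (x n + t) - h (x n)|}) := by
    intro t ht
    by_contra hnot
    simp only [Set.mem_union, Set.mem_inter_iff, Set.mem_ofPred_eq, Set.mem_preimage, not_or,
      not_and, not_le] at hnot
    have e1 := hnot.1 ht
    have e2 := hnot.2 ⟨by linarith [ht.1, (hu n).1], by linarith [ht.2, (hu n).2]⟩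
    have e3 := hxu n
    rw [← add_assoc, add_right_comm] at e2
    refine absurd e3 (not_le.2 ?_)
    rw [abs_lt] at *
    constructor <;> linarith
  calc (1 : ENNReal) = volume (Set.Icc (0 : ℝ) 1) := by simp
    _ ≤ _ := measure_mono hcover
    _ ≤ _ := measure_union_le _ _
    _ = _ := by rw [measure_preimage_add_right]

/-- Beyond some `X`, each unit step raises `h` by less than `ε`; induct on the number of steps. -/
theorem exists_forall_le_add_mul_sub {h : ℝ → ℝ} (hm : Measurable h)
    (hlim : ∀ u : ℝ, Tendsto (fun x => h (x + u) - h x) atTop (𝓝 0)) {ε : ℝ} (hε : 0 < ε) :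
    ∃ X K : ℝ, ∀ x, X ≤ x → h x ≤ K + ε * x := by
  obtain ⟨X, hX⟩ := exists_forall_abs_add_sub_lt hm hlim hε
  have hstep : ∀ n : ℕ, ∀ x, X ≤ x → x ≤ X + n + 1 → h x ≤ h X + ε * (n + 1) := by
    intro n
    induction n with
    | zero =>
      intro x h1 h2
      have := abs_lt.1 (hX X le_rfl (x - X) ⟨by linarith, by
        rw [Nat.cast_zero] at h2; linarith⟩)
      rw [add_sub_cancel] at this
      simp only [Nat.cast_zero, zero_add, mul_one]
      linarith
    | succ n ih =>
      intro x h1 h2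
      push_cast at h2 ⊢
      rcases le_total x (X + n + 1) with h3 | h3
      · linarith [ih x h1 h3]
      · have hn : (0 : ℝ) ≤ n := n.cast_nonneg
        have e1 := ih (x - 1) (by linarith) (by linarith)
        have e2 := abs_lt.1 (hX (x - 1) (by linarith) 1 ⟨zero_le_one, le_rfl⟩)
        rw [sub_add_cancel] at e2
        linarith
  refine ⟨X, h X + ε * (1 - X), fun x hx => ?_⟩
  have h1 := Nat.floor_le (sub_nonneg.2 hx)
  have h2 := Nat.lt_floor_add_one (x - X)
  have h3 := hstep ⌊x - X⌋₊ x hx (by linarith)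
  nlinarith

/-- The function `x ↦ log L(e^x)` has increments tending to zero, hence grows at most like `ε x`. -/
theorem SlowlyVaryingAtTop.exists_abs_le_mul_rpow {L : ℝ → ℝ} (hL : SlowlyVaryingAtTop L)
    {ε : ℝ} (hε : 0 < ε) : ∃ C : ℝ, 0 ≤ C ∧ ∀ k : ℕ, 1 ≤ k → |L k| ≤ C * (k : ℝ) ^ ε := by
  obtain ⟨⟨A, hpos, hmeas⟩, hlim⟩ := hL
  -- Nothing is known about `L` below `A`, so it is cut off there to become measurable on the whole
  -- line.
  set L' : ℝ → ℝ := (Set.Ici A).indicator L with hL'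
  have hL'm : Measurable L' := by
    have h1 : Measurable ((Set.Ici A).piecewise L (fun _ => 0)) := by
      refine measurable_of_restrict_of_restrict_compl (measurableSet_Ici (a := A)) ?_ ?_
      · simpa using hmeas
      · rw [Set.domRestrict_piecewise_compl]
        exact measurable_const
    exact h1
  have hev : ∀ᶠ x : ℝ in atTop, L' (Real.exp x) = L (Real.exp x) ∧ 0 < L (Real.exp x) := by
    filter_upwards [Real.tendsto_exp_atTop.eventually_ge_atTop A] with x hx
    exact ⟨Set.indicator_of_mem hx _, hpos _ hx⟩
  have hadd : ∀ u : ℝ, Tendsto (fun x => Real.log (L' (Real.exp (x + u))) -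
      Real.log (L' (Real.exp x))) atTop (𝓝 0) := by
    intro u
    have h1 := ((hlim _ (Real.exp_pos u)).comp Real.tendsto_exp_atTop).log one_ne_zero
    rw [Real.log_one] at h1
    refine h1.congr' ?_
    filter_upwards [hev, (tendsto_atTop_add_const_right _ u tendsto_id).eventually hev]
      with x h2 h3
    simp only [id, Function.comp_apply] at h3 ⊢
    rw [h2.1, h3.1, ← Real.exp_add, add_comm u x, Real.log_div h3.2.ne' h2.2.ne']
  obtain ⟨X, K, hX⟩ := exists_forall_le_add_mul_sub
    (h := fun x => Real.log (L' (Real.exp x))) (by fun_prop) hadd hε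
  obtain ⟨N, hN⟩ : ∃ N : ℕ, ∀ k : ℕ, N ≤ k → 1 ≤ k → |L k| ≤ Real.exp K * (k : ℝ) ^ ε := by
    have h1 : ∀ᶠ x : ℝ in atTop, L (Real.exp x) ≤ Real.exp K * Real.exp (ε * x) ∧
        0 < L (Real.exp x) := by
      filter_upwards [hev, eventually_ge_atTop X] with x h2 h3
      refine ⟨?_, h2.2⟩
      rw [← Real.exp_add, ← Real.log_le_iff_le_exp h2.2, ← h2.1]
      exact hX x h3
    have h2 := (Real.tendsto_log_atTop.comp tendsto_natCast_atTop_atTop).eventually h1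
    obtain ⟨N, hN⟩ := eventually_atTop.1 h2
    refine ⟨N, fun k hk hk1 => ?_⟩
    have hk0 : (0 : ℝ) < k := by exact_mod_cast hk1
    have := hN k hk
    simp only [Function.comp_apply, Real.exp_log hk0] at this
    rw [abs_of_pos this.2, Real.rpow_def_of_pos hk0, mul_comm (Real.log _)]
    exact this.1
  -- The finite sum absorbs the indices below `N`, where the asymptotic bound says nothing.
  refine ⟨Real.exp K + ∑ i ∈ Finset.range N, |L i|, by positivity, fun k hk => ?_⟩
  have hk1 : (1 : ℝ) ≤ (k : ℝ) ^ ε := Real.one_le_rpow (by exact_mod_cast hk) hε.le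
  have hS : 0 ≤ ∑ i ∈ Finset.range N, |L i| := by positivity
  rw [add_mul]
  rcases le_or_gt N k with h | h
  · exact (hN k h hk).trans (le_add_of_nonneg_right (by positivity))
  · have h1 : |L k| ≤ ∑ i ∈ Finset.range N, |L i| :=
      Finset.single_le_sum (f := fun i : ℕ => |L i|) (fun i _ => abs_nonneg _)
        (Finset.mem_range.2 h)
    calc |L k| ≤ (∑ i ∈ Finset.range N, |L i|) * 1 := by rwa [mul_one]
      _ ≤ (∑ i ∈ Finset.range N, |L i|) * (k : ℝ) ^ ε := mul_le_mul_of_nonneg_left hk1 hS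
      _ ≤ _ := le_add_of_nonneg_left (by positivity)

/-! ### Dyadic chaining and the almost sure maximal bound. -/

/-- Round `k` down to multiples of `2^l` and telescope in `l`. According to the `l`-th binary digit
of `k`, each difference is zero or one dyadic increment of length `2^l`; Cauchy–Schwarz over the `p`
levels gives the factor `p`. The right-hand side does not depend on `k`. -/
theorem sq_le_mul_sum_dyadic_increments {S : ℕ → ℝ} (h0 : S 0 = 0) {p k : ℕ} (hk : k < 2 ^ p) :
    S k ^ 2 ≤ p * ∑ l ∈ Finset.range p, ∑ j ∈ Finset.range (2 ^ (p - l)),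
      (S (j * 2 ^ l + 2 ^ l) - S (j * 2 ^ l)) ^ 2 := by
  have htel : S k = ∑ l ∈ Finset.range p,
      (S (k / 2 ^ l * 2 ^ l) - S (k / 2 ^ (l + 1) * 2 ^ (l + 1))) := by
    rw [Finset.sum_range_sub' (fun l => S (k / 2 ^ l * 2 ^ l)), Nat.div_eq_of_lt hk]
    simp [h0]
  have hsq := sq_sum_le_card_mul_sum_sq (s := Finset.range p)
    (f := fun l => S (k / 2 ^ l * 2 ^ l) - S (k / 2 ^ (l + 1) * 2 ^ (l + 1)))
  rw [← htel, Finset.card_range] at hsq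
  refine hsq.trans (mul_le_mul_of_nonneg_left (Finset.sum_le_sum fun l hl => ?_) p.cast_nonneg)
  have hlp : l < p := Finset.mem_range.1 hl
  have hnonneg : ∀ j ∈ Finset.range (2 ^ (p - l)),
      0 ≤ (S (j * 2 ^ l + 2 ^ l) - S (j * 2 ^ l)) ^ 2 := fun j _ => sq_nonneg _
  have hdiv : k / 2 ^ (l + 1) = k / 2 ^ l / 2 := by rw [pow_succ, Nat.div_div_eq_div_mul]
  have hlt : k / 2 ^ l < 2 ^ (p - l) := by
    rw [Nat.div_lt_iff_lt_mul (by positivity), ← pow_add, Nat.sub_add_cancel hlp.le]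
    exact hk
  rcases Nat.mod_two_eq_zero_or_one (k / 2 ^ l) with hb | hb
  · have : k / 2 ^ (l + 1) * 2 ^ (l + 1) = k / 2 ^ l * 2 ^ l := by
      rw [hdiv, pow_succ', ← mul_assoc]
      congr 1
      omega
    rw [this, sub_self]
    simpa using Finset.sum_nonneg hnonneg
  · obtain ⟨j, hj⟩ : ∃ j, k / 2 ^ l = j + 1 ∧ (j + 1) / 2 * 2 = j := by
      generalize k / 2 ^ l = q at hb
      exact ⟨q - 1, by omega, by omega⟩
    have h1 : k / 2 ^ (l + 1) * 2 ^ (l + 1) = j * 2 ^ l := by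
      rw [hdiv, pow_succ', ← mul_assoc, hj.1, hj.2]
    rw [h1, hj.1, Nat.succ_mul]
    rw [hj.1] at hlt
    exact Finset.single_le_sum hnonneg (Finset.mem_range.2 (Nat.lt_of_succ_lt hlt))

/-- By Tonelli the series `∑ W p` has finite integral, so it converges almost surely and its terms
tend to zero. -/
theorem ae_tendsto_zero_of_summable_integral {Ω : Type*} [MeasurableSpace Ω] {P : Measure Ω}
    {W : ℕ → Ω → ℝ} (hint : ∀ p, Integrable (W p) P) (hnonneg : ∀ p ω, 0 ≤ W p ω)
    (hs : Summable fun p => ∫ ω, W p ω ∂P) :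
    ∀ᵐ ω ∂P, Tendsto (fun p => W p ω) atTop (𝓝 0) := by
  have hfin : ∫⁻ ω, ∑' p, ENNReal.ofReal (W p ω) ∂P ≠ ⊤ := by
    rw [lintegral_tsum fun p => (hint p).aemeasurable.ennreal_ofReal]
    simp_rw [← ofReal_integral_eq_lintegral_ofReal (hint _) (ae_of_all _ (hnonneg _))]
    rw [← ENNReal.ofReal_tsum_of_nonneg (fun p => integral_nonneg (hnonneg p)) hs]
    exact ENNReal.ofReal_ne_top
  have hm : AEMeasurable (fun ω => ∑' p, ENNReal.ofReal (W p ω)) P :=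
    AEMeasurable.tsum fun p => (hint p).aemeasurable.ennreal_ofReal
  filter_upwards [ae_lt_top' hm hfin] with ω hω
  have h1 := ENNReal.tendsto_atTop_zero_of_tsum_ne_top hω.ne
  have h2 := (ENNReal.tendsto_toReal ENNReal.zero_ne_top).comp h1
  refine h2.congr fun p => ?_
  simp [hnonneg p ω]

/-- If the increments of `S` over intervals of length `k` have second moment `O(k^β)` with `β ≥ 1`,
then almost surely `max_{k ≤ n} |S k| = o(n^(β/2+ε))`. -/
theorem ae_eventually_forall_abs_le_of_integral_increments_sq_le {Ω : Type*} [MeasurableSpace Ω]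
    {P : Measure Ω} {S : ℕ → Ω → ℝ} (h0 : ∀ ω, S 0 ω = 0) (hL2 : ∀ n, MemLp (S n) 2 P)
    {C β : ℝ} (hC : 0 ≤ C) (hβ : 1 ≤ β)
    (hvar : ∀ a k : ℕ, ∫ ω, (S (a + k) ω - S a ω) ^ 2 ∂P ≤ C * (k : ℝ) ^ β)
    {ε : ℝ} (hε : 0 < ε) :
    ∀ᵐ ω ∂P, ∀ c : ℝ, 0 < c → ∀ᶠ n : ℕ in atTop, ∀ k ≤ n,
      |S k ω| ≤ c * (n : ℝ) ^ (β / 2 + ε) := by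
  set Z : ℕ → Ω → ℝ := fun p ω => p * ∑ l ∈ Finset.range p, ∑ j ∈ Finset.range (2 ^ (p - l)),
    (S (j * 2 ^ l + 2 ^ l) ω - S (j * 2 ^ l) ω) ^ 2 with hZ
  set D : ℝ := β + 2 * ε with hD
  have hinc : ∀ a b, Integrable (fun ω => (S a ω - S b ω) ^ 2) P := fun a b =>
    ((hL2 a).sub (hL2 b)).integrable_sq
  have hinner : ∀ p l, Integrable (fun ω => ∑ j ∈ Finset.range (2 ^ (p - l)),
      (S (j * 2 ^ l + 2 ^ l) ω - S (j * 2 ^ l) ω) ^ 2) P := fun p l =>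
    integrable_finsetSum _ fun j _ => hinc _ _
  have hZint : ∀ p, Integrable (Z p) P := fun p =>
    (integrable_finsetSum _ fun l _ => hinner p l).const_mul _
  have hZnonneg : ∀ p ω, 0 ≤ Z p ω := fun p ω => by
    simp only [hZ]
    exact mul_nonneg p.cast_nonneg
      (Finset.sum_nonneg fun l _ => Finset.sum_nonneg fun j _ => sq_nonneg _)
  have hZle : ∀ p : ℕ, ∫ ω, Z p ω ∂P ≤ C * (p : ℝ) ^ 2 * ((2 : ℝ) ^ β) ^ p := by
    intro p
    simp only [hZ]
    rw [integral_const_mul, integral_finsetSum _ fun l _ => hinner p l]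
    have hterm : ∀ l ∈ Finset.range p, ∫ ω, ∑ j ∈ Finset.range (2 ^ (p - l)),
        (S (j * 2 ^ l + 2 ^ l) ω - S (j * 2 ^ l) ω) ^ 2 ∂P ≤ C * ((2 : ℝ) ^ β) ^ p := by
      intro l hl
      have hlp : l ≤ p := (Finset.mem_range.1 hl).le
      rw [integral_finsetSum _ fun j _ => hinc _ _]
      refine (Finset.sum_le_card_nsmul _ _ _ fun j _ => hvar (j * 2 ^ l) (2 ^ l)).trans ?_
      -- Here `β ≥ 1` enters: the `2^(p-l)` blocks of level `l` number at most `2^(β(p-l))`, so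
      -- every level contributes at most `C 2^(βp)`.
      have h2 : (2 : ℝ) ≤ 2 ^ β := by
        simpa using Real.rpow_le_rpow_of_exponent_le one_le_two hβ
      have h3 : (((2 ^ l : ℕ) : ℝ)) ^ β = ((2 : ℝ) ^ β) ^ l := by
        rw [Nat.cast_pow, Nat.cast_ofNat, ← Real.rpow_natCast, ← Real.rpow_natCast,
          ← Real.rpow_mul zero_le_two, ← Real.rpow_mul zero_le_two, mul_comm]
      rw [Finset.card_range, nsmul_eq_mul, h3, mul_left_comm]
      refine mul_le_mul_of_nonneg_left ?_ hC
      calc ((2 ^ (p - l) : ℕ) : ℝ) * ((2 : ℝ) ^ β) ^ l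
          ≤ ((2 : ℝ) ^ β) ^ (p - l) * ((2 : ℝ) ^ β) ^ l := by
            push_cast
            gcongr
        _ = ((2 : ℝ) ^ β) ^ p := by rw [← pow_add, Nat.sub_add_cancel hlp]
    refine (mul_le_mul_of_nonneg_left (Finset.sum_le_card_nsmul _ _ _ hterm)
      p.cast_nonneg).trans (le_of_eq ?_)
    rw [Finset.card_range, nsmul_eq_mul]
    ring
  -- The surplus `2ε` in `D` leaves the series `∑ p² 2^(-2εp)`.
  have hsum : Summable fun p : ℕ => ∫ ω, Z p ω / ((2 : ℝ) ^ D) ^ p ∂P := by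
    have hq : ‖(2 : ℝ) ^ (-(2 * ε))‖ < 1 := by
      rw [Real.norm_of_nonneg (by positivity)]
      exact Real.rpow_lt_one_of_one_lt_of_neg one_lt_two (by linarith)
    have hg := (summable_pow_mul_geometric_of_norm_lt_one 2 hq).mul_left C
    refine Summable.of_nonneg_of_le
      (fun p => integral_nonneg fun ω => div_nonneg (hZnonneg p ω) (by positivity))
      (fun p => ?_) hg
    rw [integral_div, div_le_iff₀ (by positivity)]
    refine (hZle p).trans (le_of_eq ?_)
    have : (2 : ℝ) ^ (-(2 * ε)) * (2 : ℝ) ^ D = (2 : ℝ) ^ β := by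
      rw [← Real.rpow_add two_pos, hD]
      congr 1
      ring
    rw [← this, mul_pow]
    ring
  filter_upwards [ae_tendsto_zero_of_summable_integral (fun p => (hZint p).div_const _)
    (fun p ω => div_nonneg (hZnonneg p ω) (by positivity)) hsum] with ω hω c hc
  have hc' : 0 < c ^ 2 / 2 ^ D := by positivity
  obtain ⟨N, hN⟩ := eventually_atTop.1 (hω.eventually (gt_mem_nhds hc'))
  filter_upwards [eventually_ge_atTop (2 ^ N)] with n hn k hk
  have hn0 : n ≠ 0 := (lt_of_lt_of_le (by positivity) hn).ne'
  -- This gives `n < 2^p ≤ 2n`; the loss of a factor `2` is compensated by the threshold `c² / 2^D`.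
  set p := Nat.log 2 n + 1 with hp
  have hNp : N ≤ p := (Nat.le_log_of_pow_le one_lt_two hn).trans (Nat.le_succ _)
  have hnp : n < 2 ^ p := Nat.lt_pow_succ_log_self one_lt_two n
  have hpn : 2 ^ p ≤ 2 * n := by
    rw [hp, pow_succ']
    exact Nat.mul_le_mul_left 2 (Nat.pow_log_le_self 2 hn0)
  have h1 : S k ω ^ 2 ≤ Z p ω :=
    sq_le_mul_sum_dyadic_increments (S := fun n => S n ω) (h0 ω) (hk.trans_lt hnp)
  have h2 := hN p hNp
  rw [div_lt_iff₀ (by positivity)] at h2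
  have h3 : ((2 : ℝ) ^ D) ^ p ≤ 2 ^ D * (n : ℝ) ^ D := by
    rw [← Real.mul_rpow zero_le_two n.cast_nonneg, ← Real.rpow_natCast, ← Real.rpow_mul zero_le_two,
      mul_comm D, Real.rpow_mul zero_le_two, Real.rpow_natCast]
    refine Real.rpow_le_rpow (by positivity) (by exact_mod_cast hpn) ?_
    rw [hD]; linarith
  have h4 : S k ω ^ 2 ≤ (c * (n : ℝ) ^ (β / 2 + ε)) ^ 2 := by
    calc S k ω ^ 2 ≤ c ^ 2 / 2 ^ D * ((2 : ℝ) ^ D) ^ p := h1.trans h2.le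
      _ ≤ c ^ 2 / 2 ^ D * (2 ^ D * (n : ℝ) ^ D) := mul_le_mul_of_nonneg_left h3 hc'.le
      _ = c ^ 2 * (n : ℝ) ^ D := by
        have : (2 : ℝ) ^ D ≠ 0 := by positivity
        field_simp
      _ = _ := by
        rw [mul_pow, ← Real.rpow_natCast ((n : ℝ) ^ (β / 2 + ε)), ← Real.rpow_mul n.cast_nonneg]
        congr 2
        rw [hD]
        push_cast
        ring
  exact abs_le_of_sq_le_sq h4 (by positivity)

/-! ### Second moments of block sums. -/

/-- With truncated subtraction, `i - j + (j - i)` is the distance `|i - j|`. On each side of `i` it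
is injective in `j` with values below `k`, whence the factor `2`. -/
theorem sum_Ioc_dist_le {ρ : ℕ → ℝ} (hρ : ∀ d, 0 ≤ ρ d) {a k i : ℕ}
    (hi : i ∈ Finset.Ioc a (a + k)) :
    ∑ j ∈ Finset.Ioc a (a + k), ρ (i - j + (j - i)) ≤ 2 * ∑ d ∈ Finset.range k, ρ d := by
  have key : ∀ s : Finset ℕ, (Set.InjOn (fun j => i - j + (j - i)) s) →
      s ⊆ Finset.Ioc a (a + k) →
      ∑ j ∈ s, ρ (i - j + (j - i)) ≤ ∑ d ∈ Finset.range k, ρ d := by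
    intro s hs hsub
    rw [← Finset.sum_image (f := ρ) hs]
    refine Finset.sum_le_sum_of_subset_of_nonneg (fun d hd => ?_) fun d _ _ => hρ d
    obtain ⟨j, hj, rfl⟩ := Finset.mem_image.1 hd
    have := Finset.mem_Ioc.1 (hsub hj)
    rw [Finset.mem_Ioc] at hi
    rw [Finset.mem_range]
    omega
  rw [← Finset.sum_filter_add_sum_filter_not _ (fun j => j ≤ i), two_mul]
  refine add_le_add (key _ ?_ (Finset.filter_subset _ _)) (key _ ?_ (Finset.filter_subset _ _))
  · intro x hx y hy hxy
    simp only [Finset.coe_filter, Set.mem_ofPred_eq] at hx hy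
    dsimp only at hxy
    omega
  · intro x hx y hy hxy
    simp only [Finset.coe_filter, Set.mem_ofPred_eq] at hx hy
    dsimp only at hxy
    omega

theorem integral_sum_Ioc_sq_le {Ω : Type*} [MeasurableSpace Ω] {P : Measure Ω} {Y : ℕ → Ω → ℝ}
    (hY : ∀ i, MemLp (Y i) 2 P) {ρ : ℕ → ℝ} (hρ : ∀ d, 0 ≤ ρ d)
    (hcov : ∀ i j, |∫ ω, Y i ω * Y j ω ∂P| ≤ ρ (i - j + (j - i))) (a k : ℕ) :
    ∫ ω, (∑ i ∈ Finset.Ioc a (a + k), Y i ω) ^ 2 ∂P ≤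
      k * (2 * ∑ d ∈ Finset.range k, ρ d) := by
  have hint : ∀ i j, Integrable (fun ω => Y i ω * Y j ω) P := fun i j =>
    (hY i).integrable_mul (hY j)
  simp only [sq, Finset.sum_mul_sum]
  rw [integral_finsetSum _ fun i _ => integrable_finsetSum _ fun j _ => hint i j]
  have : ∀ i ∈ Finset.Ioc a (a + k), ∫ ω, ∑ j ∈ Finset.Ioc a (a + k), Y i ω * Y j ω ∂P ≤
      2 * ∑ d ∈ Finset.range k, ρ d := by
    intro i hi
    rw [integral_finsetSum _ fun j _ => hint i j]
    exact (Finset.sum_le_sum fun j _ => (le_abs_self _).trans (hcov i j)).trans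
      (sum_Ioc_dist_le hρ hi)
  refine (Finset.sum_le_card_nsmul _ _ _ this).trans (le_of_eq ?_)
  rw [Nat.card_Ioc, nsmul_eq_mul, Nat.add_sub_cancel_left]

/-- For `1 ≤ d < k` one has `d^(b-1-e) ≤ k^b d^(-1-e)`, and the last factor is summable. The spare
`e` avoids a separate logarithmic case at `b = 0`. -/
theorem exists_sum_range_le_mul_rpow {ρ : ℕ → ℝ} (hρ : ∀ d, 0 ≤ ρ d) {K b e : ℝ} (hK : 0 ≤ K)
    (hb : 0 ≤ b) (he : 0 < e) (h : ∀ d : ℕ, 1 ≤ d → ρ d ≤ K * (d : ℝ) ^ (b - 1 - e)) :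
    ∃ C : ℝ, 0 ≤ C ∧ ∀ k : ℕ, 1 ≤ k → ∑ d ∈ Finset.range k, ρ d ≤ C * (k : ℝ) ^ b := by
  have hsum : Summable fun d : ℕ => (d : ℝ) ^ (-1 - e) :=
    Real.summable_nat_rpow.2 (by linarith)
  have hnn : ∀ d : ℕ, 0 ≤ (d : ℝ) ^ (-1 - e) := fun d => Real.rpow_nonneg d.cast_nonneg _
  refine ⟨ρ 0 + K * ∑' d : ℕ, (d : ℝ) ^ (-1 - e),
    add_nonneg (hρ 0) (mul_nonneg hK (tsum_nonneg hnn)), fun k hk => ?_⟩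
  have hkb : 1 ≤ (k : ℝ) ^ b := Real.one_le_rpow (by exact_mod_cast hk) hb
  have hterm : ∀ d ∈ Finset.range k, ρ d ≤
      (if d = 0 then ρ 0 else 0) * (k : ℝ) ^ b + K * (k : ℝ) ^ b * (d : ℝ) ^ (-1 - e) := by
    intro d hd
    rcases Nat.eq_zero_or_pos d with rfl | hd0
    · rw [if_pos rfl]
      have := mul_le_mul_of_nonneg_left hkb (hρ 0)
      have h2 : 0 ≤ K * (k : ℝ) ^ b * ((0 : ℕ) : ℝ) ^ (-1 - e) :=
        mul_nonneg (by positivity) (hnn 0)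
      linarith
    · rw [if_neg hd0.ne', zero_mul, zero_add]
      have hd0' : (0 : ℝ) < d := by exact_mod_cast hd0
      refine (h d hd0).trans ?_
      rw [mul_assoc, show b - 1 - e = b + (-1 - e) by ring, Real.rpow_add hd0']
      have hdk : (d : ℝ) ^ b ≤ (k : ℝ) ^ b :=
        Real.rpow_le_rpow hd0'.le (by exact_mod_cast (Finset.mem_range.1 hd).le) hb
      exact mul_le_mul_of_nonneg_left (mul_le_mul_of_nonneg_right hdk (hnn d)) hK
  refine (Finset.sum_le_sum hterm).trans ?_
  rw [Finset.sum_add_distrib, ← Finset.sum_mul, ← Finset.mul_sum, add_mul, Finset.sum_ite_eq',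
    if_pos (Finset.mem_range.2 hk)]
  have h1 := hsum.sum_le_tsum (Finset.range k) fun d _ => hnn d
  have h2 := mul_le_mul_of_nonneg_left h1 (mul_nonneg hK (zero_le_one.trans hkb))
  linarith

/-! ### The Hermite remainder and the exponent `γ`. -/

/-- The remainder `H - (J_m / m!) H_m` of the Hermite expansion beyond its leading term. -/
noncomputable def hermiteRemainder (H : ℝ → ℝ) (m : ℕ) (x : ℝ) : ℝ :=
  H x - hermiteCoeff H m / (m.factorial : ℝ) * hermiteFun m x

theorem memLp_hermiteRemainder {H : ℝ → ℝ} (hH : MemLp H 2 (gaussianReal 0 1)) (m : ℕ) :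
    MemLp (hermiteRemainder H m) 2 (gaussianReal 0 1) := by
  have := hH.sub ((memLp_two_polynomial_gaussianReal (hermiteReal m)).const_mul
    (hermiteCoeff H m / (m.factorial : ℝ)))
  refine this.congr_norm (this.1.congr (ae_of_all _ fun x => ?_)) (ae_of_all _ fun x => ?_) <;>
  simp [hermiteRemainder, hermiteFun_eq_eval]

/-- Degree `0` is the mean-zero hypothesis, degrees strictly between `0` and `m` vanish by
minimality of the rank, and degree `m` is cancelled by the subtracted term. -/
theorem integral_hermiteRemainder_mul_hermiteReal {H : ℝ → ℝ}
    (hH : MemLp H 2 (gaussianReal 0 1)) (hH0 : ∫ x, H x ∂(gaussianReal 0 1) = 0) {m : ℕ}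
    (hm : HasHermiteRank H m) {q : ℕ} (hq : q < m + 1) :
    ∫ x, hermiteRemainder H m x * (hermiteReal q).eval x ∂(gaussianReal 0 1) = 0 := by
  have i1 : Integrable (fun x => H x * (hermiteReal q).eval x) (gaussianReal 0 1) :=
    hH.integrable_mul (memLp_two_polynomial_gaussianReal _)
  have i2 : Integrable (fun x => (hermiteReal m).eval x * (hermiteReal q).eval x)
      (gaussianReal 0 1) :=
    (memLp_two_polynomial_gaussianReal _).integrable_mul (memLp_two_polynomial_gaussianReal _)
  have e : ∀ x, hermiteRemainder H m x * (hermiteReal q).eval x = H x * (hermiteReal q).eval x -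
      hermiteCoeff H m / (m.factorial : ℝ) *
        ((hermiteReal m).eval x * (hermiteReal q).eval x) := fun x => by
    rw [hermiteRemainder, hermiteFun_eq_eval]; ring
  have hcoeff : ∫ x, H x * (hermiteReal q).eval x ∂(gaussianReal 0 1) = hermiteCoeff H q := by
    simp only [hermiteCoeff, hermiteFun_eq_eval]
  rw [integral_congr_ae (ae_of_all _ e), integral_sub i1 (i2.const_mul _), integral_const_mul,
    integral_hermiteReal_mul_hermiteReal, hcoeff]
  have hfac : (m.factorial : ℝ) ≠ 0 := by positivity
  rcases eq_or_ne m q with rfl | hmq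
  · simp [hfac]
  · rw [if_neg hmq, mul_zero, sub_zero]
    rcases Nat.eq_zero_or_pos q with rfl | hq0
    · rw [← hcoeff]
      simpa [hermiteReal_zero] using hH0
    · by_contra hne
      have := hm.2 (show q ∈ {q : ℕ | 1 ≤ q ∧ hermiteCoeff H q ≠ 0} from ⟨hq0, hne⟩)
      omega

theorem reductionError_eq_sum (H : ℝ → ℝ) (m : ℕ) (x : ℕ → ℝ) (t : ℝ) :
    reductionError H m x t = ∑ j ∈ Finset.Icc 1 ⌊t⌋₊, hermiteRemainder H m (x j) := by
  simp only [reductionError, hermiteRemainder, Finset.sum_sub_distrib, Finset.mul_sum]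

/-- In effect `γ = max 1 (2 - (m+1)α)`. The main proof needs only the two lower bounds on `γ`, so it
never splits into cases on `α`. -/
theorem one_le_reductionExponent {α : ℝ} (m : ℕ) : 1 ≤ reductionExponent α m := by
  rw [reductionExponent]
  split_ifs with h
  · rw [lt_div_iff₀ (by positivity)] at h
    linarith
  · exact le_rfl

theorem two_sub_le_reductionExponent {α : ℝ} (m : ℕ) :
    2 - ((m : ℝ) + 1) * α ≤ reductionExponent α m := by
  rw [reductionExponent]
  split_ifs with h
  · exact le_rfl
  · rw [not_lt, div_le_iff₀ (by positivity)] at h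
    linarith

/-! ### Covariances along the stationary sequence. -/

section Stationary

variable {Ω : Type*} [MeasurableSpace Ω] {P : Measure Ω} {η : ℕ → Ω → ℝ}

theorem IsStationarySeq.integral_mul (hstat : IsStationarySeq η P) (i j : ℕ) :
    ∫ ω, η i ω * η j ω ∂P = ∫ ω, η 0 ω * η (i - j + (j - i)) ω ∂P := by
  have key : ∀ h d : ℕ, ∫ ω, η h ω * η (d + h) ω ∂P = ∫ ω, η 0 ω * η d ω ∂P := by
    intro h d
    have := ((hstat h).comp (u := fun x : ℕ → ℝ => x 0 * x d) (by fun_prop)).integral_eq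
    simpa using this
  rcases le_total i j with h | h
  · have := key i (j - i)
    rw [Nat.sub_add_cancel h] at this
    rw [this, Nat.sub_eq_zero_of_le h, zero_add]
  · have := key j (i - j)
    rw [Nat.sub_add_cancel h] at this
    rw [Nat.sub_eq_zero_of_le h, add_zero, ← this]
    simp only [mul_comm]

theorem IsStationarySeq.map_eq_gaussianReal (hgauss : IsGaussianProcess η P)
    (hstat : IsStationarySeq η P) (hmean : ∫ ω, η 0 ω ∂P = 0) (hvar : ∫ ω, (η 0 ω) ^ 2 ∂P = 1)
    (i : ℕ) : P.map (η i) = gaussianReal 0 1 := by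
  have h1 : P.map (η i) = P.map (η 0) := by
    have := ((hstat i).comp (u := fun x : ℕ → ℝ => x 0) (by fun_prop)).map_eq
    simpa [Function.comp_def] using this
  have h2 := (hgauss.hasGaussianLaw_eval 0).map_eq_gaussianReal
  rw [h1, h2, hmean, variance_of_integral_eq_zero (hgauss.aemeasurable 0) hmean, hvar]
  simp

theorem IsStationarySeq.abs_integral_comp_mul_comp_le (hgauss : IsGaussianProcess η P)
    (hstat : IsStationarySeq η P) (hmean : ∫ ω, η 0 ω ∂P = 0) (hvar : ∫ ω, (η 0 ω) ^ 2 ∂P = 1)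
    {G : ℝ → ℝ} (hG : MemLp G 2 (gaussianReal 0 1)) {k : ℕ}
    (hk : ∀ q < k, ∫ x, G x * (hermiteReal q).eval x ∂(gaussianReal 0 1) = 0) (i j : ℕ) :
    |∫ ω, G (η i ω) * G (η j ω) ∂P| ≤
      |∫ ω, η 0 ω * η (i - j + (j - i)) ω ∂P| ^ k * ∫ x, G x ^ 2 ∂(gaussianReal 0 1) := by
  have hmap := hstat.map_eq_gaussianReal hgauss hmean hvar
  have hL2 : ∀ i, MemLp (η i) 2 P := fun i => by
    have h1 : MemLp (fun x : ℝ => x) 2 (gaussianReal 0 1) := by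
      have := memLp_two_polynomial_gaussianReal Polynomial.X
      simp only [Polynomial.eval_X] at this
      exact this
    rw [← hmap i] at h1
    exact (memLp_map_measure_iff (by fun_prop) (hgauss.aemeasurable i)).1 h1
  have hone : ∀ i, ∫ ω, (η i ω) ^ 2 ∂P = 1 := fun i => by
    have := hstat.integral_mul i i
    simp only [Nat.sub_self, add_zero, ← sq] at this
    rw [this, hvar]
  have hr1 : |∫ ω, η i ω * η j ω ∂P| ≤ 1 := by
    have hij : Integrable (fun ω => η i ω * η j ω) P := (hL2 i).integrable_mul (hL2 j)
    have hadd : Integrable (fun ω => (η i ω) ^ 2 + (η j ω) ^ 2) P :=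
      (hL2 i).integrable_sq.add (hL2 j).integrable_sq
    have hs : ∫ ω, (η i ω) ^ 2 + (η j ω) ^ 2 ∂P = 2 := by
      rw [integral_add (hL2 i).integrable_sq (hL2 j).integrable_sq, hone, hone]
      norm_num
    have u1 : ∫ ω, 2 * (η i ω * η j ω) ∂P ≤ ∫ ω, (η i ω) ^ 2 + (η j ω) ^ 2 ∂P :=
      integral_mono (hij.const_mul 2) hadd fun ω => by
        dsimp only
        nlinarith [sq_nonneg (η i ω - η j ω)]
    have u2 : ∫ ω, (-2) * (η i ω * η j ω) ∂P ≤ ∫ ω, (η i ω) ^ 2 + (η j ω) ^ 2 ∂P :=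
      integral_mono (hij.const_mul (-2)) hadd fun ω => by
        dsimp only
        nlinarith [sq_nonneg (η i ω + η j ω)]
    rw [integral_const_mul, hs] at u1 u2
    exact abs_le.2 ⟨by linarith, by linarith⟩
  rw [← hstat.integral_mul i j]
  exact _root_.abs_integral_comp_mul_comp_le (hgauss.hasGaussianLaw_prodMk) (hmap i) (hmap j) rfl
    hr1 hG hk

end Stationary

/-! ### The reduction theorem. -/

theorem lemma3p2 {Ω : Type*} [MeasurableSpace Ω] (P : Measure Ω) [IsProbabilityMeasure P]
    (η : ℕ → Ω → ℝ) (hgauss : IsGaussianProcess η P) (hstat : IsStationarySeq η P)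
    (hmean : ∫ ω, η 0 ω ∂P = 0) (hvar : ∫ ω, (η 0 ω) ^ 2 ∂P = 1)
    (α : ℝ) (hα : α ∈ Set.Ioo (0 : ℝ) 1) (L : ℝ → ℝ) (hL : SlowlyVaryingAtTop L)
    (hcov : ∀ k : ℕ, 1 ≤ k → ∫ ω, η 0 ω * η k ω ∂P = (k : ℝ) ^ (-α) * L k)
    (H : ℝ → ℝ) (hH : MemLp H 2 (gaussianReal 0 1)) (hH0 : ∫ x, H x ∂(gaussianReal 0 1) = 0)
    (m : ℕ) (hm : HasHermiteRank H m) (δ : ℝ) (hδ : 0 < δ) :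
    ∀ᵐ ω ∂P,
      (fun n : ℕ => ⨆ t : Set.Icc (0 : ℝ) n, |reductionError H m (fun j => η j ω) t|)
        =o[atTop] fun n : ℕ => (n : ℝ) ^ (reductionExponent α m / 2 + δ) := by
  set γ := reductionExponent α m with hγ
  have hγ1 : 1 ≤ γ := one_le_reductionExponent m
  have hγ2 : 2 - ((m : ℝ) + 1) * α ≤ γ := two_sub_le_reductionExponent m
  set G := hermiteRemainder H m with hGdef
  have hG : MemLp G 2 (gaussianReal 0 1) := memLp_hermiteRemainder hH m
  have hmap := hstat.map_eq_gaussianReal hgauss hmean hvar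
  have hY : ∀ i, MemLp (fun ω => G (η i ω)) 2 P := fun i => by
    have h1 := hG
    rw [← hmap i] at h1
    exact (memLp_map_measure_iff h1.1 (hgauss.aemeasurable i)).1 h1
  set M := ∫ x, G x ^ 2 ∂(gaussianReal 0 1) with hM
  have hM0 : 0 ≤ M := integral_nonneg fun x => sq_nonneg _
  set ρ : ℕ → ℝ := fun d => |∫ ω, η 0 ω * η d ω ∂P| ^ (m + 1) * M with hρ
  have hρ0 : ∀ d, 0 ≤ ρ d := fun d => mul_nonneg (by positivity) hM0
  have hcovG : ∀ i j, |∫ ω, G (η i ω) * G (η j ω) ∂P| ≤ ρ (i - j + (j - i)) :=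
    hstat.abs_integral_comp_mul_comp_le hgauss hmean hvar hG fun q hq =>
      integral_hermiteRemainder_mul_hermiteReal hH hH0 hm hq
  -- Chosen so that the power `m + 1` of the bound on `L` costs exactly `d^(δ/2)`.
  obtain ⟨C₀, hC₀, hLC⟩ := hL.exists_abs_le_mul_rpow
    (ε := δ / 2 / ((m : ℝ) + 1)) (by positivity)
  -- The exponent is `γ - 2 + δ/2`, written as `b - 1 - e` with `b = γ - 1 + δ` and `e = δ / 2` to
  -- suit the summation lemma.
  have hρle : ∀ d : ℕ, 1 ≤ d → ρ d ≤ C₀ ^ (m + 1) * M * (d : ℝ) ^ (γ - 1 + δ - 1 - δ / 2) := by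
    intro d hd
    have hd0 : (0 : ℝ) < d := by exact_mod_cast hd
    have h1 : |∫ ω, η 0 ω * η d ω ∂P| ≤ C₀ * (d : ℝ) ^ (-α + δ / 2 / ((m : ℝ) + 1)) := by
      rw [hcov d hd, abs_mul, abs_of_nonneg (by positivity), Real.rpow_add hd0, mul_left_comm]
      exact mul_le_mul_of_nonneg_left (hLC d hd) (by positivity)
    have h2 := pow_le_pow_left₀ (abs_nonneg _) h1 (m + 1)
    have h3 : ((d : ℝ) ^ (-α + δ / 2 / ((m : ℝ) + 1))) ^ (m + 1) ≤
        (d : ℝ) ^ (γ - 1 + δ - 1 - δ / 2) := by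
      rw [← Real.rpow_natCast, ← Real.rpow_mul hd0.le]
      refine Real.rpow_le_rpow_of_exponent_le (by exact_mod_cast hd) ?_
      have : (-α + δ / 2 / ((m : ℝ) + 1)) * ((m + 1 : ℕ) : ℝ) = -((m : ℝ) + 1) * α + δ / 2 := by
        push_cast
        field_simp
      rw [this]
      linarith
    calc ρ d ≤ (C₀ * (d : ℝ) ^ (-α + δ / 2 / ((m : ℝ) + 1))) ^ (m + 1) * M :=
          mul_le_mul_of_nonneg_right h2 hM0
      _ = C₀ ^ (m + 1) * M * ((d : ℝ) ^ (-α + δ / 2 / ((m : ℝ) + 1))) ^ (m + 1) := by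
          rw [mul_pow]; ring
      _ ≤ _ := mul_le_mul_of_nonneg_left h3 (by positivity)
  obtain ⟨C₁, hC₁, hsum⟩ := exists_sum_range_le_mul_rpow hρ0 (by positivity)
    (by linarith : 0 ≤ γ - 1 + δ) (half_pos hδ) hρle
  set S : ℕ → Ω → ℝ := fun n ω => ∑ j ∈ Finset.Icc 1 n, G (η j ω) with hS
  have hSinc : ∀ a k ω, S (a + k) ω - S a ω = ∑ i ∈ Finset.Ioc a (a + k), G (η i ω) := by
    intro a k ω
    have hI : ∀ n : ℕ, Finset.Icc 1 n = Finset.Ioc 0 n := fun n => by ext; simp; omega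
    simp only [hS, hI]
    rw [sub_eq_iff_eq_add', Finset.sum_Ioc_consecutive _ (Nat.zero_le _) (Nat.le_add_right _ _)]
  have hvarS : ∀ a k : ℕ, ∫ ω, (S (a + k) ω - S a ω) ^ 2 ∂P ≤ 2 * C₁ * (k : ℝ) ^ (γ + δ) := by
    intro a k
    simp only [hSinc]
    refine (integral_sum_Ioc_sq_le hY hρ0 hcovG a k).trans ?_
    rcases Nat.eq_zero_or_pos k with rfl | hk
    · simp only [Nat.cast_zero, zero_mul]
      positivity
    · have hk0 : (0 : ℝ) < k := by exact_mod_cast hk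
      have e : (k : ℝ) ^ (γ + δ) = k * (k : ℝ) ^ (γ - 1 + δ) := by
        rw [← Real.rpow_one_add' hk0.le (by linarith)]
        congr 1
        ring
      rw [e]
      have := mul_le_mul_of_nonneg_left (hsum k hk) hk0.le
      linarith
  filter_upwards [ae_eventually_forall_abs_le_of_integral_increments_sq_le (S := S) (P := P)
    (fun ω => by simp [hS]) (fun n => memLp_finsetSum _ fun j _ => hY j)
    (by positivity : 0 ≤ 2 * C₁) (by linarith : 1 ≤ γ + δ) hvarS (half_pos hδ)] with ω hω
  rw [isLittleO_iff]
  intro c hc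
  filter_upwards [hω c hc] with n hn
  -- Half of `δ` is spent on the variance exponent `γ + δ`, the other half on the chaining.
  have hexp : (γ + δ) / 2 + δ / 2 = γ / 2 + δ := by ring
  rw [hexp] at hn
  have : Nonempty (Set.Icc (0 : ℝ) n) := ⟨⟨0, le_rfl, n.cast_nonneg⟩⟩
  rw [Real.norm_of_nonneg (Real.iSup_nonneg fun t => abs_nonneg _),
    Real.norm_of_nonneg (by positivity)]
  refine ciSup_le fun t => ?_
  rw [reductionError_eq_sum]
  exact hn _ (Nat.floor_le_of_le t.2.2)
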